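/- Let $n,p,q$ be nonnegative integers with $p,q\le n$, and let $T\in\mathbb{R}^{n\times n}$ be banded with $p$ subdiagonals and $q$ superdiagonals, i.e. $T_{i,j}=0$ whenever $i-j>p$ or $j-i>q$. For increasing sequences $i_1<\dots<i_r$ and $j_1<\dots<j_r$ in $\{1,\dots,n\}$, the square submatrix of $T$ with rows $i_1,\dots,i_r$ and columns $j_1,\dots,j_r$, and its determinant (minor), are called trivial if for some $k$ the position $(i_k,j_k)$ lies outside the band, i.e. $i_k-j_k>p$ or $j_k-i_k>q$; otherwise they are called nontrivial. A matrix is called InTN if it is nonsingular and all its minors are nonnegative. For $1\le i\le n$ let $\Delta^i[T]$ be the submatrix of $T$ with rows $1,\dots,i$ and columns $n-i+1,\dots,n$, and let $\Delta_i[T]$ be the submatrix with rows $n-i+1,\dots,n$ and columns $1,\dots,i$. Then the following four conditions are equivalent: (i) $T$ is banded totally positive, i.e. all its nontrivial minors are positive. (ii) All nontrivial submatrices among the $\Delta_i[T]$ and $\Delta^i[T]$ are InTN. (iii) All nontrivial initial minors, i.e. all nontrivial minors with rows $1,\dots,r$ and columns $j,j+1,\dots,j+r-1$, or with rows $i,i+1,\dots,i+r-1$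 and columns $1,\dots,r$, are positive. (iv) There is a factorization $$T=\hat L_1\cdots\hat L_p\,D\,\hat U_q\cdots\hat U_1,\qquad \hat L_i=\begin{bmatrix}I_{p-i}&0\\0&L_i\end{bmatrix},\quad \hat U_i=\begin{bmatrix}I_{q-i}&0\\0&U_i\end{bmatrix},$$ where $D$ is a diagonal $n\times n$ matrix with positive diagonal entries; each $L_i$ ($1\le i\le p$) is an $(n-p+i)\times(n-p+i)$ matrix with ones on the diagonal, positive entries on the first subdiagonal and zeros elsewhere; and each $U_i$ ($1\le i\le q$) is an $(n-q+i)\times(n-q+i)$ matrix with ones on the diagonal, positive entries on the first superdiagonal and zeros elsewhere. -/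

import Mathlib

namespace BandedTP

/-- `T ∈ B_{p,q}`: all entries strictly below the `p`-th subdiagonal or strictly above the
`q`-th superdiagonal vanish. -/
def IsBanded {n : ℕ} (p q : ℕ) (T : Matrix (Fin n) (Fin n) ℝ) : Prop :=
  ∀ i j : Fin n, ((j : ℕ) + p < i ∨ (i : ℕ) + q < j) → T i j = 0

/-- The submatrix with rows `i 0 < i 1 < ⋯` and columns `j 0 < j 1 < ⋯` is trivial (for the band
`(p, q)`) if some diagonal position `(i k, j k)` lies strictly outside the band. -/
def IsTrivial {n r : ℕ} (p q : ℕ) (i j : Fin r ↪o Fin n) : Prop :=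
  ∃ k : Fin r, (j k : ℕ) + p < i k ∨ (i k : ℕ) + q < j k

/-- Banded totally positive with respect to the band `(p, q)`: banded, and all nontrivial minors
are positive. (The empty minor `r = 0` equals `1`.) -/
def IsBTP {n : ℕ} (p q : ℕ) (T : Matrix (Fin n) (Fin n) ℝ) : Prop :=
  IsBanded p q T ∧
    ∀ (r : ℕ) (i j : Fin r ↪o Fin n), ¬ IsTrivial p q i j → 0 < (T.submatrix i j).det

/-- Totally nonnegative: all minors are nonnegative. -/
def IsTN {n : ℕ} (A : Matrix (Fin n) (Fin n) ℝ) : Prop :=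
  ∀ (r : ℕ) (i j : Fin r ↪o Fin n), 0 ≤ (A.submatrix i j).det

/-- Nonsingular totally nonnegative. -/
def IsInTN {n : ℕ} (A : Matrix (Fin n) (Fin n) ℝ) : Prop :=
  IsTN A ∧ A.det ≠ 0

/-- The contiguous index sequence `s, s + 1, …, s + r - 1` (indices start at `0`). -/
def contiguous {n : ℕ} (r s : ℕ) (h : s + r ≤ n) : Fin r ↪o Fin n :=
  OrderEmbedding.ofStrictMono (fun k => ⟨s + k, by omega⟩)
    (fun a b hab => by
      have : (a : ℕ) < b := hab
      simp only [Fin.lt_def]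
      omega)

/-- The index sequence of the first `i` indices. -/
def firstIdx {n : ℕ} (i : ℕ) (h : i ≤ n) : Fin i ↪o Fin n :=
  contiguous i 0 (by omega)

/-- The index sequence of the last `i` indices. -/
def lastIdx {n : ℕ} (i : ℕ) (h : i ≤ n) : Fin i ↪o Fin n :=
  contiguous i (n - i) (by omega)

/-- `Δ^i[T]`: first `i` rows, last `i` columns. -/
def deltaUpper {n : ℕ} (T : Matrix (Fin n) (Fin n) ℝ) (i : ℕ) (h : i ≤ n) :
    Matrix (Fin i) (Fin i) ℝ :=
  T.submatrix (firstIdx i h) (lastIdx i h)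

/-- `Δ_i[T]`: last `i` rows, first `i` columns. -/
def deltaLower {n : ℕ} (T : Matrix (Fin n) (Fin n) ℝ) (i : ℕ) (h : i ≤ n) :
    Matrix (Fin i) (Fin i) ℝ :=
  T.submatrix (lastIdx i h) (firstIdx i h)

/-- All nontrivial `Δ_i[T]` and `Δ^i[T]` are nonsingular totally nonnegative. -/
def NontrivialDeltasInTN {n : ℕ} (p q : ℕ) (T : Matrix (Fin n) (Fin n) ℝ) : Prop :=
  ∀ (i : ℕ) (h : i ≤ n),
    (¬ IsTrivial p q (lastIdx i h) (firstIdx i h) → IsInTN (deltaLower T i h)) ∧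
    (¬ IsTrivial p q (firstIdx i h) (lastIdx i h) → IsInTN (deltaUpper T i h))

/-- All nontrivial initial (row and column) contiguous minors are positive. -/
def NontrivialInitialMinorsPos {n : ℕ} (p q : ℕ) (T : Matrix (Fin n) (Fin n) ℝ) : Prop :=
  ∀ (r s : ℕ) (h : s + r ≤ n) (h' : r ≤ n),
    (¬ IsTrivial p q (firstIdx r h') (contiguous r s h) →
      0 < (T.submatrix (firstIdx r h') (contiguous r s h)).det) ∧
    (¬ IsTrivial p q (contiguous r s h) (firstIdx r h') →
      0 < (T.submatrix (contiguous r s h) (firstIdx r h')).det)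

/-- Positive bidiagonal lower unitriangular matrix: ones on the diagonal, positive entries on the
first subdiagonal, zeros elsewhere. -/
structure IsPosBidiagLower {m : ℕ} (L : Matrix (Fin m) (Fin m) ℝ) : Prop where
  diag : ∀ i, L i i = 1
  pos : ∀ i j : Fin m, (i : ℕ) = j + 1 → 0 < L i j
  zero : ∀ i j : Fin m, i ≠ j → (i : ℕ) ≠ j + 1 → L i j = 0

/-- Positive bidiagonal upper unitriangular matrix: the transpose of a positive bidiagonal lower
unitriangular matrix. -/
def IsPosBidiagUpper {m : ℕ} (U : Matrix (Fin m) (Fin m) ℝ) : Prop :=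
  IsPosBidiagLower U.transpose

/-- The `n × n` block diagonal matrix `I_m ⊕ B`, where `B` has size `n - m`. -/
def hat {n : ℕ} (m : ℕ) (B : Matrix (Fin (n - m)) (Fin (n - m)) ℝ) :
    Matrix (Fin n) (Fin n) ℝ :=
  fun i j =>
    if h : m ≤ (i : ℕ) ∧ m ≤ (j : ℕ) then B ⟨i - m, by omega⟩ ⟨j - m, by omega⟩
    else if i = j then 1 else 0

/-- `T = L̂_1 ⋯ L̂_p * D * Û_q ⋯ Û_1` with `L̂_i = I_{p-i} ⊕ L_i`, `Û_i = I_{q-i} ⊕ U_i`, the blocks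
`L_i`, `U_i` positive bidiagonal unitriangular and `D` a positive diagonal matrix.
The index `i : Fin p` stands for the one-based index `i + 1`. -/
def HasBidiagonalFactorization {n : ℕ} (p q : ℕ) (T : Matrix (Fin n) (Fin n) ℝ) : Prop :=
  ∃ (L : (i : Fin p) → Matrix (Fin (n - (p - (i + 1)))) (Fin (n - (p - (i + 1)))) ℝ)
    (d : Fin n → ℝ)
    (U : (i : Fin q) → Matrix (Fin (n - (q - (i + 1)))) (Fin (n - (q - (i + 1)))) ℝ),
    (∀ i, IsPosBidiagLower (L i)) ∧ (∀ k, 0 < d k) ∧ (∀ i, IsPosBidiagUpper (U i)) ∧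
    T = (List.ofFn fun i : Fin p => hat (p - ((i : ℕ) + 1)) (L i)).prod * Matrix.diagonal d *
      (List.ofFn fun i : Fin q => hat (q - ((i : ℕ) + 1)) (U i)).reverse.prod

end BandedTP

namespace BandedTP
open Matrix

/-! The conditions are proved in a cycle. (i) ⇒ (ii): trivial minors of a banded matrix vanish, so a
banded totally positive matrix is totally nonnegative, and its nontrivial corner blocks are
nonsingular. (ii) ⇒ (iii): every nontrivial nonempty initial minor is a leading principal minor of
some nontrivial Δ, and those are positive for nonsingular totally nonnegative matrices
(`IsInTN.det_firstIdx_pos`, by Schur complements).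

(iii) ⇒ (iv): Neville elimination. One sweep clears the outermost subdiagonal by subtracting from
each row a multiple of its reduced predecessor. It preserves the initial minors still needed
(`det_elimRows`), which keep pivots and multipliers positive. Iterating, then treating the
transpose, leaves a positive diagonal.

(iv) ⇒ (i): minors of a bidiagonal factor are products of entries, hence nonnegative
(`IsHatBidiag.det_submatrix`). By Cauchy–Binet a minor of the product is positive once a single
chain of index sequences through the factors contributes positively. -/

/-! ### Cauchy–Binet and products of totally nonnegative matrices -/

/-- **Cauchy–Binet formula**, the sum being over increasing index sequences. -/
theorem det_mul_eq_sum_orderEmbedding {R : Type*} [CommRing R] {r n : ℕ}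
    [Fintype (Fin r ↪o Fin n)]
    (A : Matrix (Fin r) (Fin n) R) (B : Matrix (Fin n) (Fin r) R) :
    (A * B).det = ∑ k : Fin r ↪o Fin n, (A.submatrix id k).det * (B.submatrix k id).det := by
  classical
  have expand : (A * B).det =
      ∑ f : Fin r → Fin n, (∏ i, A i (f i)) * (B.submatrix f id).det := by
    have h : (A * B) = fun i => ∑ k, A i k • B k := by
      ext i j
      simp [Matrix.mul_apply, Finset.sum_apply]
    have h2 := (detRowAlternating (n := Fin r) (R := R)).toMultilinearMap.map_sum
      (fun (i : Fin r) (k : Fin n) => A i k • B k)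
    rw [h]
    refine h2.trans (Finset.sum_congr rfl fun f _ => ?_)
    exact (detRowAlternating (n := Fin r) (R := R)).toMultilinearMap.map_smul_univ
      (fun i => A i (f i)) (fun i => B (f i))
  have zero : ∀ f : Fin r → Fin n, ¬ Function.Injective f → (B.submatrix f id).det = 0 := by
    intro f hf
    simp only [Function.Injective, not_forall] at hf
    obtain ⟨a, b, hab, hne⟩ := hf
    exact det_zero_of_row_eq hne (by ext j; simp [hab])
  rw [expand]
  -- An injective map is uniquely an increasing embedding composed with a permutation; the other
  -- maps contribute zero.
  have regroup : ∑ f : Fin r → Fin n, (∏ i, A i (f i)) * (B.submatrix f id).det =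
      ∑ x : (Fin r ↪o Fin n) × Equiv.Perm (Fin r),
        (∏ i, A i (x.1 (x.2 i))) * (B.submatrix (x.1 ∘ x.2) id).det := by
    symm
    refine Finset.sum_of_injOn (fun x => x.1 ∘ x.2) ?_ (by simp) ?_ (by simp)
    · rintro ⟨k, σ⟩ - ⟨k', σ'⟩ - h
      dsimp only at h
      have hr : Set.range k = Set.range k' := by
        rw [← σ.surjective.range_comp k, ← σ'.surjective.range_comp k', h]
      have hk : k = k' := DFunLike.coe_injective ((k.strictMono.range_inj k'.strictMono).1 hr)
      subst hk
      have : σ = σ' := by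
        ext i
        exact congrArg Fin.val (k.injective (congrFun h i))
      rw [this]
    · intro f _ hf
      rw [zero f, mul_zero]
      intro hinj
      refine hf ⟨(OrderEmbedding.ofStrictMono (f ∘ Tuple.sort f)
        ((Tuple.monotone_sort f).strictMono_of_injective
          (hinj.comp (Tuple.sort f).injective)), (Tuple.sort f)⁻¹), by simp, ?_⟩
      ext i
      simp
  rw [regroup, Fintype.sum_prod_type]
  refine Finset.sum_congr rfl fun k _ => ?_
  rw [← det_transpose (A.submatrix id k), det_apply' (A.submatrix id k)ᵀ, Finset.sum_mul]
  refine Finset.sum_congr rfl fun σ _ => ?_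
  have : (B.submatrix (k ∘ σ) id).det = Equiv.Perm.sign σ * (B.submatrix k id).det :=
    det_permute σ (B.submatrix k id)
  rw [this]
  simp only [transpose_apply, submatrix_apply, id]
  ring

theorem det_submatrix_mul {n r : ℕ} [Fintype (Fin r ↪o Fin n)] (A B : Matrix (Fin n) (Fin n) ℝ)
    (i j : Fin r ↪o Fin n) :
    ((A * B).submatrix i j).det =
      ∑ k : Fin r ↪o Fin n, (A.submatrix i k).det * (B.submatrix k j).det := by
  rw [← submatrix_mul_equiv A B i (Equiv.refl _) j]
  exact det_mul_eq_sum_orderEmbedding _ _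

theorem IsTN.mul {n : ℕ} {A B : Matrix (Fin n) (Fin n) ℝ} (hA : IsTN A) (hB : IsTN B) :
    IsTN (A * B) := by
  intro r i j
  have := Fintype.ofFinite (Fin r ↪o Fin n)
  rw [det_submatrix_mul]
  exact Finset.sum_nonneg fun k _ => mul_nonneg (hA r i k) (hB r k j)

theorem IsTN.det_submatrix_mul_pos {n r : ℕ} {A B : Matrix (Fin n) (Fin n) ℝ} (hA : IsTN A)
    (hB : IsTN B) {i j : Fin r ↪o Fin n} (k : Fin r ↪o Fin n)
    (hik : 0 < (A.submatrix i k).det) (hkj : 0 < (B.submatrix k j).det) :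
    0 < ((A * B).submatrix i j).det := by
  have := Fintype.ofFinite (Fin r ↪o Fin n)
  rw [det_submatrix_mul]
  exact Finset.sum_pos' (fun k _ => mul_nonneg (hA r i k) (hB r k j))
    ⟨k, Finset.mem_univ _, mul_pos hik hkj⟩

theorem IsTN.transpose {n : ℕ} {A : Matrix (Fin n) (Fin n) ℝ} (hA : IsTN A) : IsTN Aᵀ := by
  intro r i j
  rw [← transpose_submatrix, det_transpose]
  exact hA r j i

/-! ### Sparse determinants and trivial minors -/

/-- A determinant whose nonzero entries force every contributing permutation to be monotone is
the product of its diagonal entries. -/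
theorem det_eq_prod_diag_of_forall_le {r : ℕ} {R : Type*} [CommRing R]
    (A : Matrix (Fin r) (Fin r) R)
    (h : ∀ a b c d, A a b ≠ 0 → A c d ≠ 0 → b < d → a ≤ c) : A.det = ∏ i, A i i := by
  rw [det_apply, Finset.sum_eq_single 1]
  · simp
  · intro σ _ hσ
    have : ∃ b, A (σ b) b = 0 := by
      by_contra! hne
      refine hσ ?_
      have hmono : StrictMono σ := fun b d hbd =>
        lt_of_le_of_ne (h _ _ _ _ (hne b) (hne d) hbd) (fun e => hbd.ne (σ.injective e))
      exact Equiv.ext (congrFun ((hmono.range_inj strictMono_id).1 (by simp)))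
    obtain ⟨b, hb⟩ := this
    rw [Finset.prod_eq_zero (f := fun b => A (σ b) b) (Finset.mem_univ b) hb, smul_zero]
  · simp

/-- A determinant with a lower left zero block that contains a diagonal position vanishes. -/
theorem det_eq_zero_of_forall_le_le {r : ℕ} {R : Type*} [CommRing R]
    (A : Matrix (Fin r) (Fin r) R) (k : Fin r) (h : ∀ a b, k ≤ a → b ≤ k → A a b = 0) :
    A.det = 0 := by
  rw [det_apply]
  refine Finset.sum_eq_zero fun σ _ => ?_
  have : ∃ b, b ≤ k ∧ k ≤ σ b := by
    -- Otherwise `σ` would inject `Iic k` into `Iio k`, which has one element fewer.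
    by_contra! hlt
    have h1 : (Finset.Iic k).map σ.toEmbedding ⊆ Finset.Iio k := by
      intro x hx
      simp only [Finset.mem_map, Finset.mem_Iic] at hx
      obtain ⟨b, hb, rfl⟩ := hx
      simpa using hlt b hb
    have h2 := Finset.card_le_card h1
    simp at h2
  obtain ⟨b, hb, hk⟩ := this
  rw [Finset.prod_eq_zero (f := fun b => A (σ b) b) (Finset.mem_univ b) (h _ _ hk hb), smul_zero]

/-- From a position outside the band, moving further towards the same corner stays outside, which
gives a zero block touching the diagonal. -/
theorem IsBanded.det_submatrix_eq_zero {n p q r : ℕ} {T : Matrix (Fin n) (Fin n) ℝ}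
    (hT : IsBanded p q T) {i j : Fin r ↪o Fin n} (h : IsTrivial p q i j) :
    (T.submatrix i j).det = 0 := by
  obtain ⟨k, hk | hk⟩ := h
  · refine det_eq_zero_of_forall_le_le _ k fun a b ha hb => hT _ _ (Or.inl ?_)
    have h1 : i k ≤ i a := i.monotone ha
    have h2 : j b ≤ j k := j.monotone hb
    rw [Fin.le_def] at h1 h2
    omega
  · rw [← det_transpose]
    refine det_eq_zero_of_forall_le_le _ k fun a b ha hb => hT _ _ (Or.inr ?_)
    have h1 : j k ≤ j a := j.monotone ha
    have h2 : i b ≤ i k := i.monotone hb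
    rw [Fin.le_def] at h1 h2
    omega

theorem IsBTP.isTN {n p q : ℕ} {T : Matrix (Fin n) (Fin n) ℝ} (hT : IsBTP p q T) : IsTN T := by
  intro r i j
  by_cases h : IsTrivial p q i j
  · rw [hT.1.det_submatrix_eq_zero h]
  · exact (hT.2 r i j h).le

theorem IsTN.submatrix {n m : ℕ} {A : Matrix (Fin n) (Fin n) ℝ} (hA : IsTN A)
    (i j : Fin m ↪o Fin n) : IsTN (A.submatrix i j) :=
  fun r i' j' => hA r (i'.trans i) (j'.trans j)

theorem IsBTP.nontrivialDeltasInTN {n p q : ℕ} {T : Matrix (Fin n) (Fin n) ℝ}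
    (hT : IsBTP p q T) : NontrivialDeltasInTN p q T := fun _ _ =>
  ⟨fun ht => ⟨hT.isTN.submatrix _ _, (hT.2 _ _ _ ht).ne'⟩,
    fun ht => ⟨hT.isTN.submatrix _ _, (hT.2 _ _ _ ht).ne'⟩⟩

/-! ### Minors of bidiagonal and diagonal factors -/

/-- The `n × n` matrices of the form `I_m ⊕ B` with `B` positive bidiagonal lower
unitriangular, described entrywise. -/
structure IsHatBidiag {n : ℕ} (m : ℕ) (M : Matrix (Fin n) (Fin n) ℝ) : Prop where
  diag : ∀ i, M i i = 1
  pos : ∀ i j : Fin n, (i : ℕ) = j + 1 → m ≤ j → 0 < M i j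
  zero : ∀ i j : Fin n, i ≠ j → ¬ ((i : ℕ) = j + 1 ∧ m ≤ j) → M i j = 0

theorem IsPosBidiagLower.isHatBidiag {n m : ℕ} {L : Matrix (Fin (n - m)) (Fin (n - m)) ℝ}
    (hL : IsPosBidiagLower L) : IsHatBidiag (n := n) m (hat m L) where
  diag i := by
    unfold hat
    split_ifs
    · exact hL.diag _
    · rfl
    · contradiction
  pos i j hij hj := by
    unfold hat
    rw [dif_pos ⟨by omega, hj⟩]
    exact hL.pos _ _ (by simp only; omega)
  zero i j hne h := by
    unfold hat
    have hne' : (i : ℕ) ≠ j := fun e => hne (Fin.ext e)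
    split_ifs with h1
    · exact hL.zero _ _ (by simp only [ne_eq, Fin.mk.injEq]; omega) (by simp only; omega)
    · rfl

theorem IsHatBidiag.exists_eq_hat {n m : ℕ} {M : Matrix (Fin n) (Fin n) ℝ}
    (hM : IsHatBidiag m M) :
    ∃ L : Matrix (Fin (n - m)) (Fin (n - m)) ℝ, IsPosBidiagLower L ∧ hat m L = M := by
  refine ⟨fun i j => M ⟨i + m, by omega⟩ ⟨j + m, by omega⟩,
    ⟨fun i => hM.diag _, fun i j hij => hM.pos _ _ (by simp only; omega) (by simp only; omega),
      fun i j hne hij => hM.zero _ _ ?_ (by simp only; omega)⟩, ?_⟩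
  · simp only [ne_eq, Fin.mk.injEq]
    have : (i : ℕ) ≠ j := fun e => hne (Fin.ext e)
    omega
  · ext i j
    unfold hat
    split_ifs with h1 h2
    · exact congrArg₂ M (Fin.ext (by simp only; omega)) (Fin.ext (by simp only; omega))
    · subst h2
      exact (hM.diag i).symm
    · exact (hM.zero _ _ h2 (by omega)).symm

theorem hat_transpose {n m : ℕ} (B : Matrix (Fin (n - m)) (Fin (n - m)) ℝ) :
    (hat (n := n) m B)ᵀ = hat m Bᵀ := by
  ext i j
  simp only [hat, transpose_apply, and_comm, eq_comm]

theorem IsHatBidiag.eq_or_eq_of_ne_zero {n m : ℕ} {M : Matrix (Fin n) (Fin n) ℝ}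
    (hM : IsHatBidiag m M) {i j : Fin n} (h : M i j ≠ 0) : (i : ℕ) = j ∨ (i : ℕ) = j + 1 := by
  by_contra! hne
  exact h (hM.zero i j (fun e => hne.1 (congrArg _ e)) (fun e => hne.2 e.1))

theorem IsHatBidiag.nonneg {n m : ℕ} {M : Matrix (Fin n) (Fin n) ℝ}
    (hM : IsHatBidiag m M) (i j : Fin n) : 0 ≤ M i j := by
  by_cases h1 : i = j
  · rw [h1, hM.diag]
    exact zero_le_one
  · by_cases h2 : (i : ℕ) = j + 1 ∧ m ≤ j
    · exact (hM.pos i j h2.1 h2.2).le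
    · rw [hM.zero i j h1 h2]

/-- Nonzero entries have row minus column 0 or 1, so moving at least one column to the right cannot
decrease the row. -/
theorem IsHatBidiag.det_submatrix {n m r : ℕ} {M : Matrix (Fin n) (Fin n) ℝ}
    (hM : IsHatBidiag m M) (i j : Fin r ↪o Fin n) :
    (M.submatrix i j).det = ∏ k, M (i k) (j k) := by
  refine det_eq_prod_diag_of_forall_le _ fun a b c d hab hcd hbd => ?_
  have h1 := hM.eq_or_eq_of_ne_zero hab
  have h2 := hM.eq_or_eq_of_ne_zero hcd
  have h3 : (j b : ℕ) < j d := j.strictMono hbd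
  rw [← i.le_iff_le, Fin.le_def]
  omega

theorem IsHatBidiag.isTN {n m : ℕ} {M : Matrix (Fin n) (Fin n) ℝ}
    (hM : IsHatBidiag m M) : IsTN M := by
  intro r i j
  rw [hM.det_submatrix]
  exact Finset.prod_nonneg fun k _ => hM.nonneg _ _

theorem IsHatBidiag.det_submatrix_pos {n m r : ℕ} {M : Matrix (Fin n) (Fin n) ℝ}
    (hM : IsHatBidiag m M) (i j : Fin r ↪o Fin n)
    (h : ∀ k, (i k : ℕ) = j k ∨ ((i k : ℕ) = j k + 1 ∧ m ≤ j k)) :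
    0 < (M.submatrix i j).det := by
  rw [hM.det_submatrix]
  refine Finset.prod_pos fun k _ => ?_
  rcases h k with h | h
  · rw [Fin.ext h, hM.diag]
    exact zero_lt_one
  · exact hM.pos _ _ h.1 h.2

theorem isTN_one {n : ℕ} : IsTN (1 : Matrix (Fin n) (Fin n) ℝ) :=
  IsHatBidiag.isTN (m := n) ⟨fun i => one_apply_eq i, fun i j _ _ => by omega,
    fun i j h _ => one_apply_ne h⟩

theorem isTN_diagonal {n : ℕ} {d : Fin n → ℝ} (hd : ∀ k, 0 < d k) :
    IsTN (diagonal d) := by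
  intro r i j
  rw [det_eq_prod_diag_of_forall_le]
  · refine Finset.prod_nonneg fun k _ => ?_
    rw [submatrix_apply, diagonal_apply]
    split_ifs
    · exact (hd _).le
    · rfl
  · intro a b c e hab hce hbe
    simp only [submatrix_apply, diagonal_apply, ne_eq, ite_eq_right_iff, Classical.not_imp]
      at hab hce
    rw [← i.le_iff_le, hab.1, hce.1]
    exact j.monotone hbe.le

theorem det_diagonal_submatrix_pos {n r : ℕ} {d : Fin n → ℝ} (hd : ∀ k, 0 < d k)
    (i : Fin r ↪o Fin n) : 0 < ((diagonal d).submatrix i i).det := by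
  rw [submatrix_diagonal _ _ i.injective, det_diagonal]
  exact Finset.prod_pos fun k _ => hd _

/-! ### Positivity of minors of the product -/

/-- The increasing sequence `k ↦ min (j k + 1) (i k)`. -/
def minSucc {n r : ℕ} (i j : Fin r ↪o Fin n) : Fin r ↪o Fin n :=
  OrderEmbedding.ofStrictMono (fun k => ⟨min (j k + 1) (i k), by omega⟩) (fun a b hab => by
    have h1 : (i a : ℕ) < i b := i.strictMono hab
    have h2 : (j a : ℕ) < j b := j.strictMono hab
    simp only [Fin.lt_def]
    omega)

@[simp] theorem minSucc_apply {n r : ℕ} (i j : Fin r ↪o Fin n) (k : Fin r) :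
    (minSucc i j k : ℕ) = min ((j k : ℕ) + 1) (i k) := rfl

/-- The increasing sequence `k ↦ min (i k) (j k)`. -/
def minIdx {n r : ℕ} (i j : Fin r ↪o Fin n) : Fin r ↪o Fin n :=
  OrderEmbedding.ofStrictMono (fun k => min (i k) (j k)) (fun _ _ hab =>
    min_lt_min (i.strictMono hab) (j.strictMono hab))

theorem minIdx_apply {n r : ℕ} (i j : Fin r ↪o Fin n) (k : Fin r) :
    (minIdx i j k : ℕ) = min (i k : ℕ) (j k) := Fin.coe_min _ _

theorem isTN_prod_ofFn {n p s : ℕ} (M : Fin s → Matrix (Fin n) (Fin n) ℝ)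
    (hM : ∀ i : Fin s, IsHatBidiag (p - (i + 1)) (M i)) : IsTN (List.ofFn M).prod := by
  induction s with
  | zero => simpa using isTN_one
  | succ s ih =>
    rw [List.ofFn_succ', List.concat_eq_append, List.prod_append, List.prod_singleton]
    exact (ih _ fun i => hM i.castSucc).mul (hM (Fin.last s)).isTN

/-- Each factor can move an index by at most one, and `minSucc` takes such a step from `j` towards
`i`. All `s` factors fix the columns below `p - s`, hence the last condition, which is void for `s =
p`. An index that moves lands in the active range of the next factor to the left. -/
theorem det_prod_ofFn_submatrix_pos {n p s r : ℕ} (hs : s ≤ p)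
    (M : Fin s → Matrix (Fin n) (Fin n) ℝ)
    (hM : ∀ i : Fin s, IsHatBidiag (p - (i + 1)) (M i)) (i j : Fin r ↪o Fin n)
    (hij : ∀ k, (j k : ℕ) ≤ i k ∧ (i k : ℕ) ≤ j k + s ∧ ((j k : ℕ) + s < p → (i k : ℕ) = j k)) :
    0 < ((List.ofFn M).prod.submatrix i j).det := by
  induction s generalizing i j with
  | zero =>
    have : i = j := by
      ext k
      have := hij k
      omega
    subst this
    simp [submatrix_one _ i.injective]
  | succ s ih =>
    rw [List.ofFn_succ', List.concat_eq_append, List.prod_append, List.prod_singleton]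
    refine (isTN_prod_ofFn _ fun i => hM i.castSucc).det_submatrix_mul_pos (hM (Fin.last s)).isTN
      (minSucc i j) (ih (by omega) _ (fun i => hM i.castSucc) _ _ fun k => ?_)
      ((hM (Fin.last s)).det_submatrix_pos _ _ fun k => ?_)
    · have := hij k
      rw [minSucc_apply]
      omega
    · have := hij k
      rw [minSucc_apply, Fin.val_last]
      omega

theorem prod_reverse_hat_eq_transpose {n q : ℕ}
    (U : (i : Fin q) → Matrix (Fin (n - (q - (i + 1)))) (Fin (n - (q - (i + 1)))) ℝ) :
    (List.ofFn fun i : Fin q => hat (n := n) (q - ((i : ℕ) + 1)) (U i)).reverse.prod =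
      (List.ofFn fun i : Fin q => hat (n := n) (q - ((i : ℕ) + 1)) (U i)ᵀ).prodᵀ := by
  rw [transpose_list_prod, List.map_ofFn]
  congr 3
  funext i
  rw [Function.comp_apply, hat_transpose, transpose_transpose]

theorem HasBidiagonalFactorization.isBTP {n p q : ℕ} {T : Matrix (Fin n) (Fin n) ℝ}
    (hb : IsBanded p q T) (hT : HasBidiagonalFactorization p q T) : IsBTP p q T := by
  obtain ⟨L, d, U, hL, hd, hU, rfl⟩ := hT
  refine ⟨hb, fun r i j hij => ?_⟩
  rw [prod_reverse_hat_eq_transpose]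
  have hL' := fun i => (hL i).isHatBidiag
  have hU' := fun i => IsPosBidiagLower.isHatBidiag (hU i)
  have tL := isTN_prod_ofFn _ hL'
  have tD := isTN_diagonal hd
  have tU := (isTN_prod_ofFn _ hU').transpose
  simp only [IsTrivial, not_exists, not_or, not_lt] at hij
  -- Through `minIdx`, the lower factors cover the part of each offset below the diagonal and the
  -- upper factors the part above it.
  refine (tL.mul tD).det_submatrix_mul_pos tU (minIdx i j)
    (tL.det_submatrix_mul_pos tD (minIdx i j) ?_ (det_diagonal_submatrix_pos hd _)) ?_
  · refine det_prod_ofFn_submatrix_pos le_rfl _ hL' _ _ fun k => ?_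
    have := hij k
    rw [minIdx_apply]
    omega
  · rw [← transpose_submatrix, det_transpose]
    refine det_prod_ofFn_submatrix_pos le_rfl _ hU' _ _ fun k => ?_
    have := hij k
    rw [minIdx_apply]
    omega

/-! ### Nontriviality of initial minors -/

theorem contiguous_apply {n r s : ℕ} (h : s + r ≤ n) (k : Fin r) :
    (contiguous r s h k : ℕ) = s + k := rfl

theorem firstIdx_apply {n r : ℕ} (h : r ≤ n) (k : Fin r) : (firstIdx r h k : ℕ) = k :=
  zero_add _

theorem lastIdx_apply {n r : ℕ} (h : r ≤ n) (k : Fin r) : (lastIdx r h k : ℕ) = n - r + k := rfl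

theorem IsTrivial.symm {n p q r : ℕ} {i j : Fin r ↪o Fin n} (h : IsTrivial p q i j) :
    IsTrivial q p j i := by
  obtain ⟨k, hk⟩ := h
  exact ⟨k, hk.symm⟩

theorem not_isTrivial_contiguous_firstIdx {n p q r s : ℕ} (hs : s ≤ p) (h : s + r ≤ n)
    (h' : r ≤ n) : ¬ IsTrivial p q (contiguous r s h) (firstIdx r h') := by
  rintro ⟨k, hk⟩
  rw [contiguous_apply, firstIdx_apply] at hk
  omega

theorem le_of_not_isTrivial {n p q r s : ℕ} (hr : 0 < r) (h : s + r ≤ n) (h' : r ≤ n)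
    (ht : ¬ IsTrivial p q (contiguous r s h) (firstIdx r h')) : s ≤ p := by
  by_contra! hlt
  refine ht ⟨⟨0, hr⟩, Or.inl ?_⟩
  rw [contiguous_apply, firstIdx_apply]
  simpa using hlt

/-- The diagonal positions of an initial submatrix all have the same offset `s`, so one comparison
decides triviality; the empty minor is 1. -/
theorem nontrivialInitialMinorsPos_iff {n p q : ℕ} {T : Matrix (Fin n) (Fin n) ℝ} :
    NontrivialInitialMinorsPos p q T ↔ ∀ (r s : ℕ) (h : s + r ≤ n) (h' : r ≤ n),
      (s ≤ q → 0 < (T.submatrix (firstIdx r h') (contiguous r s h)).det) ∧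
      (s ≤ p → 0 < (T.submatrix (contiguous r s h) (firstIdx r h')).det) := by
  constructor
  · intro H r s h h'
    exact ⟨fun hs => (H r s h h').1 fun ht =>
        not_isTrivial_contiguous_firstIdx hs h h' ht.symm,
      fun hs => (H r s h h').2 (not_isTrivial_contiguous_firstIdx hs h h')⟩
  · intro H r s h h'
    rcases Nat.eq_zero_or_pos r with rfl | hr
    · simp
    · exact ⟨fun ht => (H r s h h').1 (le_of_not_isTrivial hr h h' fun ht' => ht ht'.symm),
        fun ht => (H r s h h').2 (le_of_not_isTrivial hr h h' ht)⟩

theorem NontrivialInitialMinorsPos.transpose {n p q : ℕ} {T : Matrix (Fin n) (Fin n) ℝ}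
    (hT : NontrivialInitialMinorsPos p q T) : NontrivialInitialMinorsPos q p Tᵀ := by
  intro r s h h'
  rw [← transpose_submatrix, ← transpose_submatrix, det_transpose, det_transpose]
  exact ⟨fun ht => (hT r s h h').2 fun ht' => ht ht'.symm,
    fun ht => (hT r s h h').1 fun ht' => ht ht'.symm⟩

theorem IsBanded.transpose {n p q : ℕ} {T : Matrix (Fin n) (Fin n) ℝ}
    (hT : IsBanded p q T) : IsBanded q p Tᵀ := fun i j h => hT j i h.symm

/-! ### Neville elimination of one subdiagonal -/

/-- The rows obtained from those of `t` by eliminating the `(s + 1)`-st subdiagonal from top to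
bottom, each row being reduced by a multiple of its already reduced predecessor. -/
noncomputable def elimRows (s : ℕ) (t : ℕ → ℕ → ℝ) : ℕ → ℕ → ℝ
  | 0 => t 0
  | i + 1 => fun j => t (i + 1) j -
      (if s ≤ i then t (i + 1) (i - s) / elimRows s t i (i - s) else 0) * elimRows s t i j

/-- The multiplier used by `elimRows` to reduce row `i + 1`. -/
noncomputable def elimCoeff (s : ℕ) (t : ℕ → ℕ → ℝ) (i : ℕ) : ℝ :=
  if s ≤ i then t (i + 1) (i - s) / elimRows s t i (i - s) else 0

theorem elimRows_succ (s : ℕ) (t : ℕ → ℕ → ℝ) (i j : ℕ) :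
    elimRows s t (i + 1) j = t (i + 1) j - elimCoeff s t i * elimRows s t i j := rfl

theorem elimRows_of_le {s : ℕ} (t : ℕ → ℕ → ℝ) {i : ℕ} (h : i ≤ s) : elimRows s t i = t i := by
  cases i with
  | zero => rfl
  | succ i =>
    ext j
    rw [elimRows_succ, elimCoeff, if_neg (by omega), zero_mul, sub_zero]

/-- Within consecutive rows each is altered by a multiple of its predecessor; `s' ≤ s` ensures that
the first row of the block is unaltered. -/
theorem det_elimRows {s s' r : ℕ} (hs : s' ≤ s) (t : ℕ → ℕ → ℝ) (c : Fin r → ℕ) :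
    (of fun a b : Fin r => elimRows s t (s' + a) (c b)).det =
      (of fun a b : Fin r => t (s' + a) (c b)).det := by
  cases r with
  | zero => simp
  | succ r =>
    refine det_eq_of_forall_row_eq_smul_add_pred (fun a => - elimCoeff s t (s' + a)) ?_ ?_
    · intro j
      simp [elimRows_of_le t hs]
    · intro i j
      simp only [of_apply, Fin.val_succ, Fin.val_castSucc, ← add_assoc, elimRows_succ]
      ring

/-- The last diagonal entry of a triangular matrix is the quotient of two consecutive leading
minors. -/
theorem diag_pos_of_det_pos {k : ℕ} (u : ℕ → ℕ → ℝ)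
    (hu : ∀ a b, a ≤ k → b < a → u a b = 0)
    (hdet : ∀ r ≤ k + 1, 0 < (of fun a b : Fin r => u a b).det) : 0 < u k k := by
  have tri : ∀ r ≤ k + 1, (of fun a b : Fin r => u a b).det = ∏ a : Fin r, u a a := by
    intro r hr
    exact det_of_isUpperTriangular fun a b hab => hu a b (by omega) hab
  have h1 := hdet (k + 1) le_rfl
  have h0 := hdet k (by omega)
  rw [tri _ le_rfl, Fin.prod_univ_castSucc] at h1
  rw [tri _ (by omega)] at h0
  exact pos_of_mul_pos_right h1 h0.le

section Elim

variable {n s : ℕ} {t : ℕ → ℕ → ℝ}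

theorem elimRows_pos_of_zero (hdet : ∀ r, s + r ≤ n → 0 < (of fun a b : Fin r => t (s + a) b).det)
    {k : ℕ} (hk : s + k < n) (hz : ∀ a b, a ≤ k → b < a → elimRows s t (s + a) b = 0) :
    0 < elimRows s t (s + k) k :=
  diag_pos_of_det_pos (fun a b => elimRows s t (s + a) b) hz fun r hr => by
    rw [det_elimRows le_rfl t (fun b : Fin r => (b : ℕ))]
    exact hdet r (by omega)

/-- Clearing a row needs a nonzero pivot in its predecessor, and that pivot is positive because the
rows cleared so far form a triangular block with positive leading minors. -/
theorem elimRows_eq_zero (hband : ∀ i j, i < n → j + (s + 1) < i → t i j = 0)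
    (hdet : ∀ r, s + r ≤ n → 0 < (of fun a b : Fin r => t (s + a) b).det) {k : ℕ}
    (hk : s + k < n) : ∀ a b, a ≤ k → b < a → elimRows s t (s + a) b = 0 := by
  induction k with
  | zero => intro a b ha hb; omega
  | succ k ih =>
    have ih := ih (by omega)
    intro a b ha hb
    rcases Nat.lt_or_ge a (k + 1) with h | h
    · exact ih a b (by omega) hb
    · obtain rfl : a = k + 1 := by omega
      have hpos := elimRows_pos_of_zero hdet (by omega) ih
      rw [← add_assoc, elimRows_succ]
      rcases Nat.lt_or_ge b k with hbk | hbk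
      · rw [ih k b le_rfl hbk, hband _ _ (by omega) (by omega), mul_zero, sub_zero]
      · obtain rfl : b = k := by omega
        rw [elimCoeff, if_pos (by omega), Nat.add_sub_cancel_left, div_mul_cancel₀ _ hpos.ne',
          sub_self]

theorem elimRows_pos (hband : ∀ i j, i < n → j + (s + 1) < i → t i j = 0)
    (hdet : ∀ r, s + r ≤ n → 0 < (of fun a b : Fin r => t (s + a) b).det) {k : ℕ}
    (hk : s + k < n) : 0 < elimRows s t (s + k) k :=
  elimRows_pos_of_zero hdet hk (elimRows_eq_zero hband hdet hk)

/-- The numerator lies on the outermost subdiagonal, which is the diagonal of the block starting at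
row `s + 1`, triangular by bandedness. -/
theorem elimCoeff_pos (hband : ∀ i j, i < n → j + (s + 1) < i → t i j = 0)
    (hdet : ∀ r, s + r ≤ n → 0 < (of fun a b : Fin r => t (s + a) b).det)
    (hdet' : ∀ r, s + 1 + r ≤ n → 0 < (of fun a b : Fin r => t (s + 1 + a) b).det) {i : ℕ}
    (hi : i + 1 < n) (hs : s ≤ i) : 0 < elimCoeff s t i := by
  obtain ⟨k, rfl⟩ := Nat.exists_eq_add_of_le hs
  rw [elimCoeff, if_pos hs, Nat.add_sub_cancel_left]
  refine div_pos ?_ (elimRows_pos hband hdet (by omega))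
  have := diag_pos_of_det_pos (k := k) (fun a b => t (s + 1 + a) b)
    (fun a b ha hb => hband _ _ (by omega) (by omega)) (fun r hr => hdet' r (by omega))
  rwa [add_right_comm] at this

theorem elimRows_eq_zero_of_upper {q : ℕ} (hq : ∀ i j, j < n → i + q < j → t i j = 0) (i j : ℕ)
    (hj : j < n) (hij : i + q < j) : elimRows s t i j = 0 := by
  induction i with
  | zero => exact hq _ _ hj hij
  | succ i ih => rw [elimRows_succ, ih (by omega), hq _ _ hj hij, mul_zero, sub_zero]

/-- The bidiagonal matrix undoing the elimination `elimRows`. -/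
noncomputable def elimMatrix (n s : ℕ) (t : ℕ → ℕ → ℝ) : Matrix (Fin n) (Fin n) ℝ :=
  (1 : Matrix (Fin n) (Fin n) ℝ) + of fun i j : Fin n => if (i : ℕ) = j + 1 then elimCoeff s t j else 0

theorem elimMatrix_mul : elimMatrix n s t * (of fun i j : Fin n => elimRows s t i j) =
    of fun i j : Fin n => t i j := by
  rw [elimMatrix, add_mul, one_mul]
  ext ⟨i, hi⟩ l
  simp only [Matrix.add_apply, of_apply, mul_apply]
  cases i with
  | zero =>
    rw [Finset.sum_eq_zero (fun j _ => by rw [if_neg (by omega), zero_mul]), add_zero]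
    rfl
  | succ i =>
    rw [Finset.sum_eq_single ⟨i, by omega⟩, if_pos rfl, elimRows_succ]
    · ring
    · intro j _ hj
      rw [if_neg, zero_mul]
      intro e
      exact hj (Fin.ext (by simp only; omega))
    · simp

theorem isHatBidiag_elimMatrix
    (hpos : ∀ i, i + 1 < n → s ≤ i → 0 < elimCoeff s t i) :
    IsHatBidiag s (elimMatrix n s t) where
  diag i := by simp [elimMatrix]
  pos i j hij hj := by
    have hne : i ≠ j := fun e => by rw [e] at hij; omega
    simpa [elimMatrix, hij, hne] using hpos j (by omega) hj
  zero i j hne h := by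
    simp only [elimMatrix, Matrix.add_apply, one_apply_ne hne, of_apply, zero_add, ite_eq_right_iff]
    intro e
    exact if_neg fun h' => h ⟨e, h'⟩

end Elim

theorem exists_eq_hat_mul {n s q : ℕ} {T : Matrix (Fin n) (Fin n) ℝ}
    (hb : IsBanded (s + 1) q T) (hT : NontrivialInitialMinorsPos (s + 1) q T) :
    ∃ M T' : Matrix (Fin n) (Fin n) ℝ, IsHatBidiag s M ∧ T = M * T' ∧ IsBanded s q T' ∧
      NontrivialInitialMinorsPos s q T' := by
  -- Extension by zero to all of ℕ lets the row recursion run without bounds.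
  obtain ⟨t, rfl, ht⟩ : ∃ t : ℕ → ℕ → ℝ, T = of (fun i j : Fin n => t i j) ∧
      ∀ i j, ¬ i < n → t i j = 0 := by
    refine ⟨fun i j => if h : i < n ∧ j < n then T ⟨i, h.1⟩ ⟨j, h.2⟩ else 0, ?_, ?_⟩
    · ext i j
      simp
    · intro i j h
      simp [h]
  rw [nontrivialInitialMinorsPos_iff] at hT
  have hdet : ∀ s' ≤ s + 1, ∀ r, s' + r ≤ n →
      0 < (of fun a b : Fin r => t (s' + a) b).det := by
    intro s' hs' r hr
    convert (hT r s' hr (by omega)).2 hs' using 2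
    ext a b
    simp only [of_apply, submatrix_apply, contiguous_apply, firstIdx_apply]
  have hband : ∀ i j, i < n → j + (s + 1) < i → t i j = 0 := fun i j hi hij =>
    hb ⟨i, hi⟩ ⟨j, by omega⟩ (Or.inl hij)
  have hband' : ∀ i j, j < n → i + q < j → t i j = 0 := fun i j hj hij =>
    hb ⟨i, by omega⟩ ⟨j, hj⟩ (Or.inr hij)
  refine ⟨elimMatrix n s t, of fun i j => elimRows s t i j,
    isHatBidiag_elimMatrix fun i hi hs => elimCoeff_pos hband (hdet s (by omega))
      (hdet (s + 1) le_rfl) hi hs, elimMatrix_mul.symm, ?_, ?_⟩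
  · rintro i j (h | h)
    · obtain ⟨k, hk⟩ := Nat.exists_eq_add_of_le (show s ≤ (i : ℕ) by omega)
      rw [of_apply, hk]
      exact elimRows_eq_zero hband (hdet s (by omega)) (k := k) (by omega) _ _ le_rfl (by omega)
    · exact elimRows_eq_zero_of_upper hband' _ _ j.2 h
  · rw [nontrivialInitialMinorsPos_iff]
    intro r s' h h'
    refine ⟨fun hs => ?_, fun hs => ?_⟩
    · have h1 := (hT r s' h h').1 hs
      have h2 := det_elimRows (Nat.zero_le s) t fun b : Fin r => (contiguous r s' h b : ℕ)
      exact h1.trans_eq h2.symm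
    · have h1 := (hT r s' h h').2 (by omega)
      have h2 := det_elimRows hs t fun b : Fin r => (firstIdx r h' b : ℕ)
      exact h1.trans_eq h2.symm

/-! ### Assembling the factorization -/

/-- The outermost subdiagonal goes first, so its factor stands leftmost and has the largest identity
block. -/
theorem exists_eq_prod_mul {n p q : ℕ} {T : Matrix (Fin n) (Fin n) ℝ}
    (hb : IsBanded p q T) (hT : NontrivialInitialMinorsPos p q T) :
    ∃ (M : Fin p → Matrix (Fin n) (Fin n) ℝ) (T' : Matrix (Fin n) (Fin n) ℝ),
      (∀ i : Fin p, IsHatBidiag (p - (i + 1)) (M i)) ∧ T = (List.ofFn M).prod * T' ∧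
      IsBanded 0 q T' ∧ NontrivialInitialMinorsPos 0 q T' := by
  induction p generalizing T with
  | zero => exact ⟨fun _ => 1, T, fun i => i.elim0, by simp, hb, hT⟩
  | succ p ih =>
    obtain ⟨M₀, T₁, hM₀, rfl, hb₁, hT₁⟩ := exists_eq_hat_mul hb hT
    obtain ⟨M, T', hM, rfl, hb', hT'⟩ := ih hb₁ hT₁
    refine ⟨Fin.cons M₀ M, T', fun i => ?_, ?_, hb', hT'⟩
    · cases i using Fin.cases with
      | zero => simpa using hM₀
      | succ i => simpa using hM i
    · simp [List.ofFn_succ, mul_assoc]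

theorem eq_diagonal_of_isBanded_zero {n : ℕ} {T : Matrix (Fin n) (Fin n) ℝ}
    (hb : IsBanded 0 0 T) : T = diagonal fun i => T i i := by
  ext i j
  by_cases h : i = j
  · rw [h, diagonal_apply_eq]
  · rw [diagonal_apply_ne _ h]
    refine hb i j ?_
    have : (i : ℕ) ≠ j := fun e => h (Fin.ext e)
    omega

theorem diag_pos_of_initialMinorsPos {n : ℕ} {d : Fin n → ℝ}
    (hT : NontrivialInitialMinorsPos 0 0 (diagonal d)) (k : Fin n) : 0 < d k := by
  rw [nontrivialInitialMinorsPos_iff] at hT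
  have H : ∀ r (hr : r ≤ n), 0 < ∏ a : Fin r, d (firstIdx r hr a) := by
    intro r hr
    have := (hT r 0 (by omega) hr).1 le_rfl
    change 0 < ((diagonal d).submatrix (firstIdx r hr) (firstIdx r hr)).det at this
    rwa [submatrix_diagonal _ _ (firstIdx r hr).injective, det_diagonal] at this
  have h1 := H (k + 1) k.2
  have h0 := H k k.2.le
  rw [Fin.prod_univ_castSucc] at h1
  have h2 := pos_of_mul_pos_right h1 h0.le
  rwa [show firstIdx (k + 1 : ℕ) k.2 (Fin.last k) = k from Fin.ext (firstIdx_apply _ _)] at h2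

theorem NontrivialInitialMinorsPos.hasBidiagonalFactorization {n p q : ℕ}
    {T : Matrix (Fin n) (Fin n) ℝ} (hb : IsBanded p q T)
    (hT : NontrivialInitialMinorsPos p q T) : HasBidiagonalFactorization p q T := by
  obtain ⟨M, T₁, hM, rfl, hb₁, hT₁⟩ := exists_eq_prod_mul hb hT
  -- Only superdiagonals remain in `T₁`; they are eliminated as subdiagonals of its transpose, and
  -- transposing back reverses the factors.
  obtain ⟨N, T₂, hN, h₂, hb₂, hT₂⟩ := exists_eq_prod_mul hb₁.transpose hT₁.transpose
  obtain ⟨d, rfl⟩ : ∃ d, T₂ = diagonal d := ⟨_, eq_diagonal_of_isBanded_zero hb₂⟩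
  choose L hL hLM using fun i => (hM i).exists_eq_hat
  choose U hU hUN using fun i => (hN i).exists_eq_hat
  refine ⟨L, d, fun i => (U i)ᵀ, hL, diag_pos_of_initialMinorsPos hT₂, fun i => ?_, ?_⟩
  · rw [IsPosBidiagUpper, transpose_transpose]
    exact hU i
  · rw [prod_reverse_hat_eq_transpose]
    simp only [transpose_transpose, hLM, hUN]
    rw [← transpose_transpose T₁, h₂, transpose_mul, diagonal_transpose, mul_assoc]

/-! ### Nonsingular totally nonnegative matrices -/

/-- The Schur complement of the top left entry. -/
noncomputable def schurCompl {m : ℕ} (A : Matrix (Fin (m + 1)) (Fin (m + 1)) ℝ) :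
    Matrix (Fin m) (Fin m) ℝ :=
  of fun i j => A i.succ j.succ - A i.succ 0 / A 0 0 * A 0 j.succ

theorem det_eq_mul_det_schurCompl {m : ℕ} (A : Matrix (Fin (m + 1)) (Fin (m + 1)) ℝ)
    (h : A 0 0 ≠ 0) : A.det = A 0 0 * (schurCompl A).det := by
  let c : Fin (m + 1) → ℝ := Fin.cons 0 fun i => A i.succ 0 / A 0 0
  have h1 : A.det = (of fun i j => A i j - c i * A 0 j).det :=
    det_eq_of_forall_row_eq_smul_add_const c 0 rfl fun i j => by simp [c]
  rw [h1, det_succ_column_zero, Fin.sum_univ_succ, Finset.sum_eq_zero]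
  · simp only [Fin.val_zero, pow_zero, one_mul, of_apply, add_zero]
    congr 1
    · simp [c]
  · intro i _
    simp [c, h]

/-- The index sequence `0, i 0 + 1, i 1 + 1, …`. -/
def consIdx {m r : ℕ} (i : Fin r ↪o Fin m) : Fin (r + 1) ↪o Fin (m + 1) :=
  OrderEmbedding.ofStrictMono (Fin.cons 0 fun k => (i k).succ) <| by
    intro a b
    refine Fin.cases ?_ (fun b => ?_) b
    · intro h
      exact absurd h (Fin.not_lt_zero a)
    · refine Fin.cases ?_ (fun a => ?_) a
      · intro _
        simp
      · intro h
        simpa using h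

/-- Restricting to indices led by 0 commutes definitionally with the Schur complement. -/
theorem det_submatrix_consIdx {m r : ℕ} (A : Matrix (Fin (m + 1)) (Fin (m + 1)) ℝ)
    (h : A 0 0 ≠ 0) (i j : Fin r ↪o Fin m) :
    (A.submatrix (consIdx i) (consIdx j)).det =
      A 0 0 * ((schurCompl A).submatrix i j).det :=
  det_eq_mul_det_schurCompl (A.submatrix (consIdx i) (consIdx j)) h

theorem IsTN.nonneg {n : ℕ} {A : Matrix (Fin n) (Fin n) ℝ} (hA : IsTN A) (i j : Fin n) :
    0 ≤ A i j := by
  have := hA 1 (OrderEmbedding.ofStrictMono (fun _ => i) (Subsingleton.strictMono _))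
    (OrderEmbedding.ofStrictMono (fun _ => j) (Subsingleton.strictMono _))
  rwa [det_fin_one] at this

/-- If the corner were zero, nonzero entries in both the first row and the first column would give a
negative 2 × 2 minor; so one of the two vanishes, against nonsingularity. -/
theorem IsInTN.zero_zero_pos {m : ℕ} {A : Matrix (Fin (m + 1)) (Fin (m + 1)) ℝ}
    (hA : IsInTN A) : 0 < A 0 0 := by
  refine lt_of_le_of_ne (hA.1.nonneg 0 0) fun h0 => hA.2 ?_
  by_cases hcol : ∀ i, A i 0 = 0
  · exact det_eq_zero_of_column_eq_zero 0 hcol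
  by_cases hrow : ∀ j, A 0 j = 0
  · exact det_eq_zero_of_row_eq_zero 0 hrow
  push Not at hcol hrow
  obtain ⟨i, hi⟩ := hcol
  obtain ⟨j, hj⟩ := hrow
  have hi0 : 0 < i := Fin.pos_of_ne_zero fun e => hi (by rw [e, ← h0])
  have hj0 : 0 < j := Fin.pos_of_ne_zero fun e => hj (by rw [e, ← h0])
  have key : ∀ k : Fin (m + 1), 0 < k → StrictMono ![0, k] := by
    intro k hk
    simpa [Fin.strictMono_iff_lt_succ] using hk
  have := hA.1 2 (OrderEmbedding.ofStrictMono _ (key i hi0))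
    (OrderEmbedding.ofStrictMono _ (key j hj0))
  rw [det_fin_two] at this
  simp only [submatrix_apply, OrderEmbedding.coe_ofStrictMono, cons_val_zero, cons_val_one,
    ← h0, zero_mul, zero_sub] at this
  have h1 := mul_pos ((hA.1.nonneg 0 j).lt_of_ne' hj) ((hA.1.nonneg i 0).lt_of_ne' hi)
  linarith

theorem IsInTN.schurCompl {m : ℕ} {A : Matrix (Fin (m + 1)) (Fin (m + 1)) ℝ}
    (hA : IsInTN A) : IsInTN (schurCompl A) := by
  have h0 := hA.zero_zero_pos
  refine ⟨fun r i j => ?_, fun hd => hA.2 ?_⟩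
  · have := hA.1 _ (consIdx i) (consIdx j)
    rw [det_submatrix_consIdx A h0.ne'] at this
    exact nonneg_of_mul_nonneg_right this h0
  · rw [det_eq_mul_det_schurCompl A h0.ne', hd, mul_zero]

/-- The leading principal minors of a nonsingular totally nonnegative matrix are positive. -/
theorem IsInTN.det_firstIdx_pos {m r : ℕ} {A : Matrix (Fin m) (Fin m) ℝ} (hA : IsInTN A)
    (h : r ≤ m) : 0 < (A.submatrix (firstIdx r h) (firstIdx r h)).det := by
  induction m generalizing r with
  | zero =>
    obtain rfl : r = 0 := by omega
    simp
  | succ m ih =>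
    cases r with
    | zero => simp
    | succ r =>
      have h0 := hA.zero_zero_pos
      have : firstIdx (r + 1) h = consIdx (firstIdx r (by omega)) := by
        ext k
        rw [firstIdx_apply]
        refine Fin.cases rfl (fun k => ?_) k
        exact congrArg (· + 1) (firstIdx_apply (Nat.le_of_succ_le_succ h) k).symm
      rw [this, det_submatrix_consIdx A h0.ne']
      exact mul_pos h0 (ih hA.schurCompl _)

/-- An initial minor of offset `s` is a leading principal minor of the Δ of size `n - s`, whose
diagonal positions also have offset `s`. -/
theorem NontrivialDeltasInTN.nontrivialInitialMinorsPos {n p q : ℕ}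
    {T : Matrix (Fin n) (Fin n) ℝ} (hT : NontrivialDeltasInTN p q T) :
    NontrivialInitialMinorsPos p q T := by
  rw [nontrivialInitialMinorsPos_iff]
  intro r s h h'
  have hr : r ≤ n - s := by omega
  have e1 : ∀ k, firstIdx (n - s) (Nat.sub_le n s) (firstIdx r hr k) = firstIdx r h' k := by
    intro k
    ext
    simp only [firstIdx_apply]
  have e2 : ∀ k, lastIdx (n - s) (Nat.sub_le n s) (firstIdx r hr k) = contiguous r s h k := by
    intro k
    ext
    simp only [firstIdx_apply, lastIdx_apply, contiguous_apply]
    omega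
  refine ⟨fun hs => ?_, fun hs => ?_⟩
  · have := ((hT (n - s) (Nat.sub_le n s)).2 ?_).det_firstIdx_pos hr
    · simpa only [deltaUpper, submatrix_submatrix, Function.comp_def, e1, e2] using this
    · rintro ⟨k, hk⟩
      rw [firstIdx_apply, lastIdx_apply] at hk
      omega
  · have := ((hT (n - s) (Nat.sub_le n s)).1 ?_).det_firstIdx_pos hr
    · simpa only [deltaLower, submatrix_submatrix, Function.comp_def, e1, e2] using this
    · rintro ⟨k, hk⟩
      rw [firstIdx_apply, lastIdx_apply] at hk
      omega

end BandedTP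

theorem mainTheorem2 (n p q : ℕ) (hp : p ≤ n) (hq : q ≤ n)
    (T : Matrix (Fin n) (Fin n) ℝ) (hT : BandedTP.IsBanded p q T) :
    List.TFAE [
      BandedTP.IsBTP p q T,
      BandedTP.NontrivialDeltasInTN p q T,
      BandedTP.NontrivialInitialMinorsPos p q T,
      BandedTP.HasBidiagonalFactorization p q T] := by
  tfae_have 1 → 2 := fun h => h.nontrivialDeltasInTN
  tfae_have 2 → 3 := fun h => h.nontrivialInitialMinorsPos
  tfae_have 3 → 4 := fun h => h.hasBidiagonalFactorization hT
  tfae_have 4 → 1 := fun h => h.isBTP hT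
  tfae_finish
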